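/- Let $n\ge 1$. For $y\in\mathbb{R}$ let $\langle y\rangle$ be the unique point of $[-1/2,1/2)$ congruent to $y$ modulo $1$. For a real matrix $\mathbf X\in\mathbb{R}^{m\times k}$ and $\boldsymbol\theta\in\mathbb{R}^m$, let $\omega^\times(\mathbf X,\boldsymbol\theta)\in[0,\infty]$ be the supremum of the $w\ge 0$ such that for arbitrarily large $Q>1$ there is a nonzero $\mathbf q\in\mathbb{Z}^k$ with $$\prod_{j=1}^m\bigl|\langle(\mathbf X\mathbf q+\boldsymbol\theta)_j\rangle\bigr|<Q^{-mw}\quad\text{and}\quad \prod_{i=1}^k\max\{1,|q_i|\}\le Q^k .$$ For $\mathbf x\in\mathbb{R}^n$, write $\omega_0^\times(\mathbf x,\boldsymbol\theta)$ (with $\boldsymbol\theta\in\mathbb{R}^n$) for this exponent when $\mathbf X=\mathbf x$ is regarded as an $n\times 1$ matrix, and $\omega_{n-1}^\times(\mathbf x,\theta)$ (with $\theta\in\mathbb{R}$) when $\mathbf X={}^t\mathbf x$ is regarded as a $1\times n$ matrix. Put $\omega_0^\times(\mathbf x)=\omega_0^\times(\mathbf x,\mathbf 0)$ and $\omega_{n-1}^\times(\mathbf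 x)=\omega_{n-1}^\times(\mathbf x,0)$. Let $\mathcal M\subset\mathbb{R}^n$ be a $d$-dimensional differentiable (embedded) submanifold, and let $\mu$ be the $d$-dimensional volume measure on $\mathcal M$ (equivalently, up to null sets, the push-forward of Lebesgue measure on $\mathbb{R}^d$ by local parametrizations). "Almost every $\mathbf x\in\mathcal M$" refers to $\mu$. For $i\in\{0,n-1\}$ put $$\omega_i^\times(\mathcal M)=\sup\{v\in\mathbb{R}:\ \mu\{\mathbf x:\omega_i^\times(\mathbf x)>v\}>0\}$$ (for $n=1$, where the two indices coincide, the simultaneous and the dual exponents are still understood as above). **Theorem.** Suppose that at almost every point of $\mathcal M$ the tangent plane is not orthogonal to any of the coordinate axes. Then for every $\boldsymbol\theta\in\mathbb{R}^n$ $$\omega_0^\times(\mathbf x,\boldsymbol\theta)\ \ge\ \frac{1-(n-1)\,\omega_0^\times(\mathcal M)}{n\,\omega_0^\times(\mathcal M)}\qquad\text{for almost every }\mathbf x\in\mathcal M,$$ and for every $\theta\in\mathbb{R}$ $$\omega_{n-1}^\times(\mathbf x,\theta)\ \ge\ \frac{n}{\omega_{n-1}^\times(\mathcal M)-(n-1)}\qquad\text{for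 almost every }\mathbf x\in\mathcal M.$$ If $\omega_0^\times(\mathcal M)=\infty$ or $\omega_{n-1}^\times(\mathcal M)=\infty$, the corresponding right-hand side is read as $0$. -/

import Mathlib

open MeasureTheory

noncomputable section

/-- The representative in `[-1/2, 1/2)` of the class of `y` modulo `1`. -/
def centeredRep (y : ℝ) : ℝ := y - ⌊y + 1 / 2⌋

/-- The pair of inequalities that defines the multiplicative exponent, at the exponent `w` and
the height `Q`: some nonzero `q ∈ ℤⁿ` satisfies `∏ⱼ |⟨X q + θ⟩ⱼ| < Q ^ (-m w)` and
`∏ᵢ max 1 |qᵢ| ≤ Q ^ n`. -/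
def MulSolvable {m n : ℕ} (X : Matrix (Fin m) (Fin n) ℝ) (θ : Fin m → ℝ) (w Q : ℝ) : Prop :=
  ∃ q : Fin n → ℤ, q ≠ 0 ∧
    ∏ j : Fin m, |centeredRep ((X.mulVec (fun i => (q i : ℝ)) + θ) j)| < Q ^ (-((m : ℝ) * w)) ∧
    ∏ i : Fin n, max 1 |(q i : ℝ)| ≤ Q ^ n

/-- The multiplicative inhomogeneous Diophantine exponent `ω^×(X, θ)`: the supremum, possibly
infinite, of the `w ≥ 0` that are admissible for arbitrarily large `Q > 1`. -/
def mulExponent {m n : ℕ} (X : Matrix (Fin m) (Fin n) ℝ) (θ : Fin m → ℝ) : EReal :=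
  sSup {e : EReal | ∃ w : ℝ, e = (w : EReal) ∧ 0 ≤ w ∧
    ∀ Q₀ : ℝ, ∃ Q : ℝ, Q₀ < Q ∧ 1 < Q ∧ MulSolvable X θ w Q}

/-- The simultaneous multiplicative exponent `ω₀^×(x, θ)`, in which `x ∈ ℝⁿ` is an
`n × 1` matrix and `θ ∈ ℝⁿ`. -/
def omegaSim {n : ℕ} (x : EuclideanSpace ℝ (Fin n)) (θ : Fin n → ℝ) : EReal :=
  mulExponent (Matrix.of fun (j : Fin n) (_ : Fin 1) => x j) θ

/-- The dual multiplicative exponent `ω_{n-1}^×(x, θ)`, in which `x ∈ ℝⁿ` is a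
`1 × n` matrix and `θ ∈ ℝ`. -/
def omegaDual {n : ℕ} (x : EuclideanSpace ℝ (Fin n)) (θ : ℝ) : EReal :=
  mulExponent (Matrix.of fun (_ : Fin 1) (i : Fin n) => x i) (fun _ => θ)

/-- The exponent of a measure `μ` attached to a pointwise exponent `ω`:
`sup {v | μ {x | ω x > v} > 0}`. -/
def measureExponent {α : Type*} [MeasurableSpace α] (μ : Measure α) (ω : α → EReal) : EReal :=
  sSup {e : EReal | ∃ v : ℝ, e = (v : EReal) ∧ 0 < μ {x | (v : EReal) < ω x}}

/-- `f : U → ℝⁿ` is a local parametrization of the `d`-dimensional set `M`: `U ⊆ ℝᵈ` is open,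
`f` is differentiable on `U` with injective derivatives, it is a homeomorphism of `U` onto its
image, and this image is a relatively open subset of `M`. -/
structure IsLocalParam {d n : ℕ} (M : Set (EuclideanSpace ℝ (Fin n)))
    (U : Set (EuclideanSpace ℝ (Fin d)))
    (f : EuclideanSpace ℝ (Fin d) → EuclideanSpace ℝ (Fin n)) : Prop where
  isOpen : IsOpen U
  differentiableAt : ∀ u ∈ U, DifferentiableAt ℝ f u
  injective_fderiv : ∀ u ∈ U, Function.Injective (fderiv ℝ f u)
  isEmbedding : Topology.IsEmbedding (U.domRestrict f)
  image_open : ∃ V : Set (EuclideanSpace ℝ (Fin n)), IsOpen V ∧ f '' U = M ∩ V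

/-- `M` is a `d`-dimensional differentiable (embedded) submanifold of `ℝⁿ`. No continuity of the
derivatives is required, so that the `C^k` submanifolds are included for all `k ≥ 1`. -/
def IsDiffSubmanifold (d : ℕ) {n : ℕ} (M : Set (EuclideanSpace ℝ (Fin n))) : Prop :=
  ∀ x ∈ M, ∃ (U : Set (EuclideanSpace ℝ (Fin d)))
    (f : EuclideanSpace ℝ (Fin d) → EuclideanSpace ℝ (Fin n)), IsLocalParam M U f ∧ x ∈ f '' U

/-- The (directions of the) tangent plane of `M` at `x`: the range of the derivative of a local
parametrization at the point over `x`. -/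
def tangentPlane (d : ℕ) {n : ℕ} (M : Set (EuclideanSpace ℝ (Fin n)))
    (x : EuclideanSpace ℝ (Fin n)) : Set (EuclideanSpace ℝ (Fin n)) :=
  {v | ∃ (U : Set (EuclideanSpace ℝ (Fin d)))
    (f : EuclideanSpace ℝ (Fin d) → EuclideanSpace ℝ (Fin n)) (u : EuclideanSpace ℝ (Fin d)),
    IsLocalParam M U f ∧ u ∈ U ∧ f u = x ∧ ∃ h, fderiv ℝ f u h = v}

/-- The tangent plane of `M` at `x` is orthogonal to the `i`-th coordinate axis. -/
def TangentOrthAxis (d : ℕ) {n : ℕ} (M : Set (EuclideanSpace ℝ (Fin n)))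
    (x : EuclideanSpace ℝ (Fin n)) (i : Fin n) : Prop :=
  ∀ v ∈ tangentPlane d M x, inner ℝ v (EuclideanSpace.single i (1 : ℝ)) = 0

/-- The `d`-dimensional volume on `M`, as a measure on `ℝⁿ`: the `d`-dimensional Hausdorff
measure restricted to `M`. For a `d`-dimensional submanifold this is the Riemannian measure up to
a constant factor, and it has the same null sets as the push-forwards of Lebesgue measure on `ℝᵈ`
by local parametrizations. -/
def surfaceMeasure (d : ℕ) {n : ℕ} (M : Set (EuclideanSpace ℝ (Fin n))) :
    Measure (EuclideanSpace ℝ (Fin n)) :=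
  (Measure.hausdorffMeasure (d : ℝ)).restrict M

/-- `ω₀^×(M)`. -/
def omegaSimManifold (d : ℕ) {n : ℕ} (M : Set (EuclideanSpace ℝ (Fin n))) : EReal :=
  measureExponent (surfaceMeasure d M) (fun x => omegaSim x 0)

/-- `ω_{n-1}^×(M)`. -/
def omegaDualManifold (d : ℕ) {n : ℕ} (M : Set (EuclideanSpace ℝ (Fin n))) : EReal :=
  measureExponent (surfaceMeasure d M) (fun x => omegaDual x 0)

end

/-! ### Covering radius of a lattice with no short vectors -/

section Lattice

variable {ι : Type*} [Fintype ι]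

/-! The argument is a pointwise transference for each matrix `X`. If `w` exceeds the homogeneous
exponent, then for every large `Q` the box `|q i| < Q`, `|X q + p| < Q ^ (-w)` has no nonzero
integer point, since cubes satisfy the product conditions. Rescaling the box to the unit sup ball
gives a lattice with no nonzero vector shorter than `1` and covolume `Δ = Q ^ (m w - n)`. Every
point then lies within `Δ` of the lattice (`ZSpan.one_le_covolume_and_infDist_lt`), so the
inhomogeneous system has solutions of height about `Δ Q` and error below `Δ Q ^ (-w)`. Comparing
powers of `Q` gives the exponent `(w + n - m w) / (1 - n + m w)`, which specializes to both bounds.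
Almost every point of `M` has homogeneous exponent at most that of `M` (`ae_le_measureExponent`). -/

lemma Submodule.infDist_add_mem {E : Type*} [SeminormedAddCommGroup E] (L : Submodule ℤ E)
    {l : E} (hl : l ∈ L) (y : E) :
    Metric.infDist (l + y) (L : Set E) = Metric.infDist y (L : Set E) := by
  have key : ∀ l ∈ L, ∀ y : E,
      Metric.infDist (l + y) (L : Set E) ≤ Metric.infDist y (L : Set E) := by
    intro l hl y
    refine (Metric.le_infDist ⟨0, L.zero_mem⟩).2 fun z hz => ?_
    calc Metric.infDist (l + y) (L : Set E) ≤ dist (l + y) (l + z) :=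
          Metric.infDist_le_dist_of_mem (L.add_mem hl hz)
      _ = dist y z := dist_add_left _ _ _
  refine le_antisymm (key l hl y) ?_
  simpa using key (-l) (L.neg_mem hl) (l + y)

/-- If all nonzero vectors of a lattice have sup norm at least `1`, then a point at distance at
least `J` from the lattice forces the covolume to be at least `J + 1`: the segment from the origin
to this point contains points at the distances `0, …, J`, and the balls of radius `1 / 2` around
these are disjoint modulo the lattice. -/
lemma ZSpan.natCast_add_one_le_covolume [DecidableEq ι] (b : Module.Basis ι ℝ (ι → ℝ))
    (hb : ∀ l ∈ Submodule.span ℤ (Set.range b), ‖l‖ < 1 → l = 0) (y : ι → ℝ) (J : ℕ)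
    (hJ : (J : ℝ) ≤ Metric.infDist y (Submodule.span ℤ (Set.range b) : Set (ι → ℝ))) :
    (J : ℝ) + 1 ≤ |(Matrix.of b).det| := by
  set L := Submodule.span ℤ (Set.range b) with hL
  set D : (ι → ℝ) → ℝ := fun z => Metric.infDist z (L : Set (ι → ℝ)) with hD
  have hpath : ∀ j : Fin (J + 1), ∃ t : ι → ℝ, D t = (j : ℕ) := by
    intro j
    have hc : ContinuousOn (fun s : ℝ => D (s • y)) (Set.Icc 0 1) :=
      ((Metric.continuous_infDist_pt _).comp
        (continuous_id.smul continuous_const)).continuousOn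
    have hmem : ((j : ℕ) : ℝ) ∈ Set.Icc (D ((0 : ℝ) • y)) (D ((1 : ℝ) • y)) := by
      constructor
      · rw [zero_smul, hD]
        simp only [Metric.infDist_zero_of_mem (show (0 : ι → ℝ) ∈ (L : Set (ι → ℝ)) from
          L.zero_mem)]
        positivity
      · rw [one_smul]
        exact le_trans (by exact_mod_cast Nat.lt_succ_iff.1 j.2) hJ
    obtain ⟨s, -, hs⟩ := intermediate_value_Icc zero_le_one hc hmem
    exact ⟨_, hs⟩
  choose t ht using hpath
  -- The distance to `L` is `1`-Lipschitz and `L`-periodic, so centres less than `1` apart modulo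
  -- `L` have the same integer distance; then `l - l'` is shorter than `1`.
  have hkey : ∀ i j : Fin (J + 1), ∀ l ∈ L, ∀ l' ∈ L, ∀ u v : ι → ℝ,
      u ∈ Metric.ball (t i) (1 / 2) → v ∈ Metric.ball (t j) (1 / 2) → l + u = l' + v →
      i = j ∧ l = l' := by
    intro i j l hl l' hl' u v hu hv huv
    have hd : dist (l + t i) (l' + t j) < 1 := by
      calc dist (l + t i) (l' + t j) ≤ dist (l + t i) (l + u) + dist (l + u) (l' + t j) :=
            dist_triangle _ _ _
        _ = dist u (t i) + dist v (t j) := by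
            rw [huv, dist_add_left, dist_comm u, ← huv, dist_add_left]
        _ < 1 := by
            rw [Metric.mem_ball] at hu hv; linarith
    have h1 : |((i : ℕ) : ℝ) - ((j : ℕ) : ℝ)| < 1 := by
      have h2 := Metric.lipschitz_infDist_pt (L : Set (ι → ℝ)) |>.dist_le_mul (l + t i) (l' + t j)
      rw [Submodule.infDist_add_mem L hl, Submodule.infDist_add_mem L hl', Real.dist_eq] at h2
      have h3 := ht i
      have h4 := ht j
      simp only [hD] at h3 h4
      rw [h3, h4] at h2
      simp only [NNReal.coe_one, one_mul] at h2
      exact h2.trans_lt hd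
    have hij : i = j := by
      rw [abs_lt] at h1
      have h5 : (i : ℕ) < (j : ℕ) + 1 := by exact_mod_cast (by linarith : ((i : ℕ) : ℝ) < (j : ℕ) + 1)
      have h6 : (j : ℕ) < (i : ℕ) + 1 := by exact_mod_cast (by linarith : ((j : ℕ) : ℝ) < (i : ℕ) + 1)
      exact Fin.ext (by omega)
    refine ⟨hij, sub_eq_zero.1 (hb _ (L.sub_mem hl hl') ?_)⟩
    rwa [hij, dist_add_right, dist_eq_norm] at hd
  -- Sup balls of radius `1 / 2` have volume `1`, so their union would have volume `J + 1` above the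
  -- covolume, and Blichfeldt's principle would make two translates meet.
  by_contra hlt
  push Not at hlt
  set S : Set (ι → ℝ) := ⋃ j, Metric.ball (t j) (1 / 2) with hS
  have hSo : IsOpen S := isOpen_iUnion fun j => Metric.isOpen_ball
  have hvol : volume S = ((J + 1 : ℕ) : ENNReal) := by
    rw [hS, measure_iUnion]
    · simp [Real.volume_pi_ball]
    · intro i j hij
      refine Set.disjoint_left.2 fun u hu hv => hij ?_
      exact (hkey i j 0 L.zero_mem 0 L.zero_mem u u hu hv rfl).1
    · exact fun j => Metric.isOpen_ball.measurableSet
  have hcov : volume (ZSpan.fundamentalDomain b) < volume S := by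
    rw [ZSpan.volume_fundamentalDomain, hvol, ENNReal.ofReal_lt_iff_lt_toReal (abs_nonneg _)
      (ENNReal.natCast_ne_top _)]
    rw [ENNReal.toReal_natCast]
    exact_mod_cast hlt
  have : Countable L.toAddSubgroup := inferInstanceAs (Countable (Submodule.span ℤ (Set.range b)))
  obtain ⟨l, l', hne, hdis⟩ := exists_pair_mem_lattice_not_disjoint_vadd
    (ZSpan.isAddFundamentalDomain' b volume) hSo.measurableSet.nullMeasurableSet hcov
  obtain ⟨z, ⟨u, hu, rfl⟩, ⟨v, hv, hz⟩⟩ := Set.not_disjoint_iff.1 hdis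
  obtain ⟨i, hu⟩ := Set.mem_iUnion.1 hu
  obtain ⟨j, hv⟩ := Set.mem_iUnion.1 hv
  exact hne (Subtype.ext (hkey i j l l.2 l' l'.2 u v hu hv hz.symm).2)

/-- Take `J = 0` at the origin for the first bound, and `J` the integer part of the distance for the
second. -/
lemma ZSpan.one_le_covolume_and_infDist_lt [DecidableEq ι] (b : Module.Basis ι ℝ (ι → ℝ))
    (hb : ∀ l ∈ Submodule.span ℤ (Set.range b), ‖l‖ < 1 → l = 0) :
    1 ≤ |(Matrix.of b).det| ∧ ∀ y : ι → ℝ,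
      Metric.infDist y (Submodule.span ℤ (Set.range b) : Set (ι → ℝ)) < |(Matrix.of b).det| := by
  constructor
  · simpa using ZSpan.natCast_add_one_le_covolume b hb 0 0 (by simpa using Metric.infDist_nonneg)
  · intro y
    exact (Nat.lt_floor_add_one _).trans_le
      (ZSpan.natCast_add_one_le_covolume b hb y _ (Nat.floor_le Metric.infDist_nonneg))

end Lattice

/-! ### Transference for systems of linear forms -/

/-- A homogeneous system of linear forms without small integer solutions is inhomogeneously
solvable: the transference principle in terms of the covolume `(Q ^ n * C ^ m)⁻¹`. -/
lemma exists_inhomogeneous_of_homogeneous {m n : ℕ} (X : Matrix (Fin m) (Fin n) ℝ) {Q C : ℝ}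
    (hQ : 0 < Q) (hC : 0 < C)
    (hX : ∀ (q : Fin n → ℤ) (p : Fin m → ℤ), (∀ i, |(q i : ℝ)| < Q) →
      (∀ j, |X.mulVec (fun i => (q i : ℝ)) j + p j| < C) → q = 0 ∧ p = 0) :
    1 ≤ (Q ^ n * C ^ m)⁻¹ ∧ ∀ (a : Fin n → ℝ) (θ : Fin m → ℝ),
      ∃ (q : Fin n → ℤ) (p : Fin m → ℤ), (∀ i, |(q i : ℝ) - a i| < (Q ^ n * C ^ m)⁻¹ * Q) ∧
        ∀ j, |X.mulVec (fun i => (q i : ℝ)) j + θ j + p j| < (Q ^ n * C ^ m)⁻¹ * C := by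
  -- The rows span the vectors with coordinates `q i / Q` and `(X q + p) j / C`, which turns the box
  -- into the unit sup ball.
  set A : Matrix (Fin n ⊕ Fin m) (Fin n ⊕ Fin m) ℝ :=
    Matrix.fromBlocks (Q⁻¹ • 1) (C⁻¹ • X.transpose) 0 (C⁻¹ • 1) with hA
  have hdet : A.det = (Q ^ n * C ^ m)⁻¹ := by
    rw [hA, Matrix.det_fromBlocks_zero₂₁, Matrix.det_smul, Matrix.det_smul]
    simp [mul_comm]
  have hpos : 0 < (Q ^ n * C ^ m)⁻¹ := by positivity
  have hunit : IsUnit A :=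
    (Matrix.isUnit_iff_isUnit_det A).2 (by rw [hdet]; exact hpos.ne'.isUnit)
  have hli : LinearIndependent ℝ A.row := Matrix.linearIndependent_rows_iff_isUnit.2 hunit
  let _ := Classical.dec (Nonempty (Fin n ⊕ Fin m))
  set b : Module.Basis (Fin n ⊕ Fin m) ℝ (Fin n ⊕ Fin m → ℝ) :=
    basisOfPiSpaceOfLinearIndependent hli with hbdef
  have hbA : (b : Fin n ⊕ Fin m → Fin n ⊕ Fin m → ℝ) = A.row := by simp [hbdef]
  have hof : Matrix.of b = A := by rw [hbA]; rfl
  have hinl : ∀ (z : Fin n ⊕ Fin m → ℤ) (i : Fin n),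
      (∑ s, z s • b s) (Sum.inl i) = Q⁻¹ * z (Sum.inl i) := by
    intro z i
    simp [hbA, hA, Matrix.row, Matrix.one_apply, mul_comm]
  have hinr : ∀ (z : Fin n ⊕ Fin m → ℤ) (j : Fin m),
      (∑ s, z s • b s) (Sum.inr j) =
        C⁻¹ * (X.mulVec (fun i => (z (Sum.inl i) : ℝ)) j + z (Sum.inr j)) := by
    intro z j
    simp only [hbA, hA, Matrix.row, Finset.sum_apply, Fintype.sum_sum_type, Pi.smul_apply]
    simp only [Matrix.fromBlocks_apply₁₂, Matrix.fromBlocks_apply₂₂, Matrix.smul_apply,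
      Matrix.transpose_apply, Matrix.one_apply, Matrix.mulVec, dotProduct, zsmul_eq_mul,
      smul_eq_mul, mul_add, Finset.mul_sum]
    congr 1
    · exact Finset.sum_congr rfl fun i _ => by ring
    · simp [mul_comm]
  have hb : ∀ l ∈ Submodule.span ℤ (Set.range b), ‖l‖ < 1 → l = 0 := by
    intro l hl hl1
    obtain ⟨z, rfl⟩ := (Submodule.mem_span_range_iff_exists_fun ℤ).1 hl
    rw [pi_norm_lt_iff one_pos] at hl1
    obtain ⟨hq, hp⟩ := hX (fun i => z (Sum.inl i)) (fun j => z (Sum.inr j)) (fun i => by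
        have := hl1 (Sum.inl i)
        rwa [hinl, Real.norm_eq_abs, abs_mul, abs_of_pos (inv_pos.2 hQ), inv_mul_lt_one₀ hQ]
          at this) (fun j => by
        have := hl1 (Sum.inr j)
        rwa [hinr, Real.norm_eq_abs, abs_mul, abs_of_pos (inv_pos.2 hC), inv_mul_lt_one₀ hC]
          at this)
    refine Finset.sum_eq_zero fun s _ => ?_
    have hz : z s = 0 := by
      cases s with
      | inl i => exact congrFun hq i
      | inr j => exact congrFun hp j
    rw [hz, zero_smul]
  obtain ⟨h1, h2⟩ := ZSpan.one_le_covolume_and_infDist_lt b hb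
  rw [hof, hdet, abs_of_pos hpos] at h1 h2
  refine ⟨h1, fun a θ => ?_⟩
  obtain ⟨l, hl, hdist⟩ := (Metric.infDist_lt_iff ⟨0, Submodule.zero_mem _⟩).1
    (h2 (Sum.elim (fun i => Q⁻¹ * a i) (fun j => C⁻¹ * -θ j)))
  obtain ⟨z, rfl⟩ := (Submodule.mem_span_range_iff_exists_fun ℤ).1 hl
  rw [dist_comm, dist_pi_lt_iff hpos] at hdist
  refine ⟨fun i => z (Sum.inl i), fun j => z (Sum.inr j), fun i => ?_, fun j => ?_⟩
  · have := hdist (Sum.inl i)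
    rwa [hinl, Sum.elim_inl, Real.dist_eq, ← mul_sub, abs_mul, abs_of_pos (inv_pos.2 hQ),
      inv_mul_lt_iff₀ hQ, mul_comm Q] at this
  · have := hdist (Sum.inr j)
    rw [hinr, Sum.elim_inr, Real.dist_eq, ← mul_sub, abs_mul, abs_of_pos (inv_pos.2 hC),
      inv_mul_lt_iff₀ hC, mul_comm C] at this
    rwa [sub_neg_eq_add, add_right_comm] at this

lemma abs_centeredRep_le (y : ℝ) (p : ℤ) : |centeredRep y| ≤ |y + p| := by
  have h := round_le y (-p)
  rw [round_eq] at h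
  simpa [centeredRep] using h

lemma abs_centeredRep_le_half (y : ℝ) : |centeredRep y| ≤ 1 / 2 := by
  have h := abs_sub_round y
  rwa [round_eq] at h

lemma prod_lt_pow_of_lt {m : ℕ} (hm : 1 ≤ m) {f : Fin m → ℝ} {c : ℝ} (hf : ∀ j, 0 ≤ f j)
    (hfc : ∀ j, f j < c) : ∏ j, f j < c ^ m := by
  have : NeZero m := ⟨by omega⟩
  have hc : 0 < c := (hf 0).trans_lt (hfc 0)
  -- Strict monotonicity of products needs positive factors; a vanishing factor is settled by `0 <
  -- c`.
  by_cases h0 : ∃ j, f j = 0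
  · obtain ⟨j, hj⟩ := h0
    rw [Finset.prod_eq_zero (Finset.mem_univ j) hj]
    positivity
  · push Not at h0
    calc ∏ j, f j < ∏ _j : Fin m, c :=
          Finset.prod_lt_prod_of_nonempty (fun j _ => (hf j).lt_of_ne' (h0 j))
            (fun j _ => hfc j) Finset.univ_nonempty
      _ = c ^ m := by simp

/-! ### Transference for the multiplicative exponents -/

section Exponent

variable {m n : ℕ}

lemma le_mulExponent {X : Matrix (Fin m) (Fin n) ℝ} {θ : Fin m → ℝ} {w : ℝ} (hw : 0 ≤ w)
    (h : ∀ Q₀ : ℝ, ∃ Q : ℝ, Q₀ < Q ∧ 1 < Q ∧ MulSolvable X θ w Q) :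
    (w : EReal) ≤ mulExponent X θ :=
  le_sSup ⟨w, rfl, hw, h⟩

lemma mulExponent_nonneg (hm : 1 ≤ m) (hn : 1 ≤ n) (X : Matrix (Fin m) (Fin n) ℝ)
    (θ : Fin m → ℝ) : 0 ≤ mulExponent X θ := by
  have : NeZero n := ⟨by omega⟩
  refine le_mulExponent (w := 0) le_rfl fun Q₀ => ⟨max Q₀ 1 + 1, ?_, ?_, fun _ => 1, ?_, ?_, ?_⟩
  · linarith [le_max_left Q₀ 1]
  · linarith [le_max_right Q₀ 1]
  · exact fun h => one_ne_zero (congrFun h 0)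
  · simpa using prod_lt_pow_of_lt hm (c := 1) (fun j => abs_nonneg _)
      (fun j => (abs_centeredRep_le_half _).trans_lt (by norm_num))
  · simpa using one_le_pow₀ (n := n) (by linarith [le_max_right Q₀ 1] : 1 ≤ max Q₀ 1 + 1)

/-- Above the homogeneous exponent, the boxes `|q| < Q`, `|X q + p| < Q ^ (-w)` contain no nonzero
integer point once `Q` is large. -/
lemma exists_forall_eq_zero_of_mulExponent_lt (hm : 1 ≤ m) (hn : 1 ≤ n)
    {X : Matrix (Fin m) (Fin n) ℝ} {w : ℝ} (hw : mulExponent X 0 < w) :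
    ∃ Q₀ : ℝ, ∀ Q : ℝ, Q₀ < Q → 1 < Q → ∀ (q : Fin n → ℤ) (p : Fin m → ℤ),
      (∀ i, |(q i : ℝ)| < Q) →
      (∀ j, |X.mulVec (fun i => (q i : ℝ)) j + p j| < Q ^ (-w)) → q = 0 ∧ p = 0 := by
  have hw0 : 0 < w := by exact_mod_cast (mulExponent_nonneg hm hn X 0).trans_lt hw
  have hex : ∃ Q₀ : ℝ, ∀ Q : ℝ, Q₀ < Q → 1 < Q → ¬ MulSolvable X 0 w Q := by
    by_contra! h
    exact (le_mulExponent hw0.le h).not_gt hw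
  obtain ⟨Q₀, hQ₀⟩ := hex
  refine ⟨Q₀, fun Q hQ hQ1 q p hq hp => ?_⟩
  have hq0 : q = 0 := by
    by_contra hne
    refine hQ₀ Q hQ hQ1 ⟨q, hne, ?_, ?_⟩
    · have h := prod_lt_pow_of_lt hm
        (f := fun j => |centeredRep ((X.mulVec (fun i => (q i : ℝ)) + 0) j)|)
        (fun j => abs_nonneg _) (fun j => ((abs_centeredRep_le _ (p j)).trans_lt
          (by simpa using hp j)))
      rwa [← Real.rpow_mul_natCast (by linarith), neg_mul, mul_comm w] at h
    · calc ∏ i, max 1 |(q i : ℝ)| ≤ ∏ _i : Fin n, Q :=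
            Finset.prod_le_prod (fun i _ => by positivity)
              (fun i _ => max_le hQ1.le (hq i).le)
        _ = Q ^ n := by simp
  refine ⟨hq0, funext fun j => ?_⟩
  have h1 : |(p j : ℝ)| < 1 := by
    have h2 := (hp j).trans (Real.rpow_lt_one_of_one_lt_of_neg hQ1 (neg_neg_of_pos hw0))
    simpa [hq0, Matrix.mulVec, dotProduct] using h2
  exact Int.abs_lt_one_iff.1 (by exact_mod_cast h1)

/-- Transference between the homogeneous and the inhomogeneous exponents. -/
lemma le_mulExponent_of_mulExponent_zero_lt (hm : 1 ≤ m) (hn : 1 ≤ n)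
    {X : Matrix (Fin m) (Fin n) ℝ} {w : ℝ} (hw : mulExponent X 0 < w) :
    (n : ℝ) ≤ m * w ∧ ∀ (θ : Fin m → ℝ) (v : ℝ), 0 ≤ v →
      v * (1 - n + m * w) < w + n - m * w → (v : EReal) ≤ mulExponent X θ := by
  have : NeZero n := ⟨by omega⟩
  obtain ⟨Q₀, hQ₀⟩ := exists_forall_eq_zero_of_mulExponent_lt hm hn hw
  have hcov : ∀ Q : ℝ, 1 < Q → (Q ^ n * (Q ^ (-w)) ^ m)⁻¹ = Q ^ (m * w - n) := by
    intro Q hQ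
    have hQ0 : 0 < Q := by linarith
    rw [← Real.rpow_mul_natCast hQ0.le, ← Real.rpow_natCast Q n, ← Real.rpow_add hQ0,
      ← Real.rpow_neg hQ0.le]
    congr 1
    ring
  -- The covolume `Q ^ (m w - n)` is at least `1` with `Q > 1`, so its exponent is nonnegative.
  have hnm : (n : ℝ) ≤ m * w := by
    have hQ1 : 1 < max Q₀ 1 + 1 := by linarith [le_max_right Q₀ 1]
    have h := (exists_inhomogeneous_of_homogeneous X (by linarith : 0 < max Q₀ 1 + 1)
      (Real.rpow_pos_of_pos (by linarith) (-w))
      (hQ₀ (max Q₀ 1 + 1) (by linarith [le_max_left Q₀ 1]) hQ1)).1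
    rw [hcov _ hQ1] at h
    by_contra! hlt
    exact (Real.rpow_lt_one_of_one_lt_of_neg hQ1 (by linarith)).not_ge h
  refine ⟨hnm, fun θ v hv hvw => le_mulExponent hv fun R₀ => ?_⟩
  -- The gap in `hvw` lets a power of `Q` absorb the factor `3 ^ v` coming from the height `3 * T`.
  obtain ⟨Q, hQv, hQ⟩ := ((tendsto_rpow_atTop (sub_pos.2 hvw)).eventually_ge_atTop
    ((3 : ℝ) ^ v) |>.and (Filter.eventually_gt_atTop (max (max Q₀ R₀) 1))).exists
  simp only [max_lt_iff] at hQ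
  obtain ⟨⟨hQQ₀, hQR₀⟩, hQ1⟩ := hQ
  have hQ0 : 0 < Q := by linarith
  obtain ⟨-, h⟩ := exists_inhomogeneous_of_homogeneous X hQ0 (Real.rpow_pos_of_pos hQ0 (-w))
    (hQ₀ Q hQQ₀ hQ1)
  rw [hcov Q hQ1] at h
  have hT : Q ^ ((m : ℝ) * w - n) * Q = Q ^ (1 - n + m * w) := by
    rw [← Real.rpow_add_one hQ0.ne']
    congr 1
    ring
  have hC : Q ^ ((m : ℝ) * w - n) * Q ^ (-w) = Q ^ (-(w + n - m * w)) := by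
    rw [← Real.rpow_add hQ0]
    congr 1
    ring
  rw [hT, hC] at h
  set T := Q ^ (1 - (n : ℝ) + m * w) with hTdef
  have hTQ : Q ≤ T := by
    simpa using Real.rpow_le_rpow_of_exponent_le hQ1.le (by linarith : 1 ≤ 1 - (n : ℝ) + m * w)
  have hT0 : 0 < T := by linarith
  -- Centring the box of radius `T` at `2 * T` in each coordinate forces `T < q i < 3 * T`, hence `q
  -- ≠ 0`.
  obtain ⟨q, p, hq, hp⟩ := h (fun _ => 2 * T) θ
  simp only [abs_lt] at hq
  refine ⟨3 * T, by linarith, by linarith, q, fun h0 => ?_, ?_, ?_⟩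
  · have := (hq 0).1
    rw [h0] at this
    simp only [Pi.zero_apply, Int.cast_zero] at this
    linarith
  · have hle : Q ^ (-(w + n - m * w)) ≤ (3 * T) ^ (-v) := by
      rw [Real.rpow_neg hQ0.le, Real.rpow_neg (by positivity), Real.mul_rpow (by norm_num) hT0.le,
        hTdef, ← Real.rpow_mul hQ0.le]
      refine inv_anti₀ (by positivity) ?_
      rw [← le_div_iff₀ (by positivity), ← Real.rpow_sub hQ0, mul_comm _ v]
      exact hQv
    have h := prod_lt_pow_of_lt hm
      (f := fun j => |centeredRep ((X.mulVec (fun i => (q i : ℝ)) + θ) j)|)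
      (fun j => abs_nonneg _)
      (fun j => (abs_centeredRep_le _ (p j)).trans_lt ((hp j).trans_le hle))
    rwa [← Real.rpow_mul_natCast (by positivity), neg_mul, mul_comm v] at h
  · calc ∏ i, max 1 |(q i : ℝ)| ≤ ∏ _i : Fin n, 3 * T :=
          Finset.prod_le_prod (fun i _ => by positivity)
            (fun i _ => max_le (by linarith)
              (abs_le.2 ⟨by linarith [(hq i).1], by linarith [(hq i).2]⟩))
      _ = (3 * T) ^ n := by simp

/-- The transference inequality at any real upper bound of the homogeneous exponent. -/
lemma div_le_mulExponent_of_mulExponent_zero_le (hm : 1 ≤ m) (hn : 1 ≤ n)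
    {X : Matrix (Fin m) (Fin n) ℝ} {w : ℝ} (hw : mulExponent X 0 ≤ w) :
    (n : ℝ) ≤ m * w ∧ ∀ θ : Fin m → ℝ,
      (((w + n - m * w) / (1 - n + m * w) : ℝ) : EReal) ≤ mulExponent X θ := by
  have hlt : ∀ w' : ℝ, w < w' → mulExponent X 0 < w' := fun w' h =>
    hw.trans_lt (by exact_mod_cast h)
  have hm0 : (0 : ℝ) < m := by exact_mod_cast hm
  have hnm : (n : ℝ) ≤ m * w := by
    rw [← div_le_iff₀' hm0]
    refine le_of_forall_gt_imp_ge_of_dense fun w' h => ?_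
    rw [div_le_iff₀' hm0]
    exact (le_mulExponent_of_mulExponent_zero_lt hm hn (hlt w' h)).1
  have hα : 0 < 1 - (n : ℝ) + m * w := by linarith
  refine ⟨hnm, fun θ => ?_⟩
  refine le_of_forall_lt fun c hc => ?_
  obtain ⟨v, hcv, hv⟩ := EReal.lt_iff_exists_real_btwn.1 hc
  refine hcv.trans_le ?_
  rcases lt_or_ge v 0 with hv0 | hv0
  · exact le_trans (by exact_mod_cast hv0.le) (mulExponent_nonneg hm hn X θ)
  have hv' : v * (1 - n + m * w) < w + n - m * w := by
    rw [← lt_div_iff₀ hα]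
    exact_mod_cast hv
  -- The previous lemma needs a strict upper bound; the inequality for `v` is an open condition and
  -- survives a slight increase of `w`.
  have hcont : ∀ᶠ w' in nhdsWithin w (Set.Ioi w), v * (1 - n + m * w') < w' + n - m * w' := by
    refine Filter.Eventually.filter_mono nhdsWithin_le_nhds ?_
    exact ContinuousAt.eventually_lt (f := fun w' : ℝ => v * (1 - n + m * w'))
      (g := fun w' : ℝ => w' + n - m * w') (by fun_prop) (by fun_prop) hv'
  obtain ⟨w', hw', hww'⟩ := (hcont.and self_mem_nhdsWithin).exists
  exact (le_mulExponent_of_mulExponent_zero_lt hm hn (hlt w' hww')).2 θ v hv0 hw'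

end Exponent

/-! ### From points to manifolds -/

/-- Each superlevel set at a rational level above the supremum is null, and countably many of these
cover the exceptional set. -/
lemma ae_le_measureExponent {α : Type*} [MeasurableSpace α] (μ : Measure α) (ω : α → EReal) :
    ∀ᵐ x ∂μ, ω x ≤ measureExponent μ ω := by
  have h : ∀ r : ℚ, measureExponent μ ω < ((r : ℝ) : EReal) →
      ∀ᵐ x ∂μ, ω x ≤ ((r : ℝ) : EReal) := by
    intro r hr
    rw [ae_iff]
    by_contra h0
    refine hr.not_ge (le_sSup ⟨r, rfl, ?_⟩)
    simpa only [not_le] using pos_iff_ne_zero.2 h0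
  have hall : ∀ᵐ x ∂μ, ∀ r : ℚ, measureExponent μ ω < ((r : ℝ) : EReal) →
      ω x ≤ ((r : ℝ) : EReal) :=
    ae_all_iff.2 fun r => by
      by_cases hr : measureExponent μ ω < ((r : ℝ) : EReal)
      · filter_upwards [h r hr] with x hx _ using hx
      · exact Filter.Eventually.of_forall fun x hx => absurd hx hr
  filter_upwards [hall] with x hx
  by_contra! hlt
  obtain ⟨r, hr1, hr2⟩ := EReal.lt_iff_exists_rat_btwn.1 hlt
  exact (hx r hr1).not_gt hr2

lemma transference_le_omegaSim {n : ℕ} (hn : 1 ≤ n) {x : EuclideanSpace ℝ (Fin n)} {W : EReal}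
    (hW : omegaSim x 0 ≤ W) (θ : Fin n → ℝ) :
    (1 - ((n : EReal) - 1) * W) / ((n : EReal) * W) ≤ omegaSim x θ := by
  have hn0 : (0 : EReal) < (n : EReal) := by exact_mod_cast hn
  induction W with
  | bot => exact absurd (((mulExponent_nonneg hn le_rfl _ _).trans hW)) (by simp)
  -- In `EReal` division by `⊤` gives `0`, which is the stated convention.
  | top =>
    rw [EReal.mul_top_of_pos hn0, EReal.div_top]
    exact mulExponent_nonneg hn le_rfl _ _
  | coe w =>
    refine le_trans (le_of_eq ?_) ((div_le_mulExponent_of_mulExponent_zero_le hn le_rfl hW).2 θ)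
    -- The denominator `n * w` is at least `1`, by the first conclusion of the transference, so the
    -- quotient is a genuine one.
    have h1 : (1 - ((n : EReal) - 1) * (w : EReal)) / ((n : EReal) * w) =
        (((1 - ((n : ℝ) - 1) * w) / (n * w) : ℝ) : EReal) := by
      simp only [EReal.coe_div, EReal.coe_sub, EReal.coe_mul, EReal.coe_coe_eq_natCast, EReal.coe_one]
    rw [h1]
    congr 2 <;> push_cast <;> ring

lemma transference_le_omegaDual {n : ℕ} (hn : 1 ≤ n) {x : EuclideanSpace ℝ (Fin n)} {W : EReal}
    (hW : omegaDual x 0 ≤ W) (θ : ℝ) :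
    (n : EReal) / (W - ((n : EReal) - 1)) ≤ omegaDual x θ := by
  induction W with
  | bot => exact absurd (((mulExponent_nonneg le_rfl hn _ _).trans hW)) (by simp)
  | top =>
    have h1 : (⊤ : EReal) - ((n : EReal) - 1) = ⊤ := by
      have : (n : EReal) - 1 = (((n : ℝ) - 1 : ℝ) : EReal) := by
        simp only [EReal.coe_sub, EReal.coe_coe_eq_natCast, EReal.coe_one]
      rw [this, EReal.top_sub_coe]
    rw [h1, EReal.div_top]
    exact mulExponent_nonneg le_rfl hn _ _
  | coe w =>
    refine le_trans (le_of_eq ?_)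
      ((div_le_mulExponent_of_mulExponent_zero_le le_rfl hn hW).2 fun _ => θ)
    have h1 : (n : EReal) / ((w : EReal) - ((n : EReal) - 1)) =
        (((n : ℝ) / (w - ((n : ℝ) - 1)) : ℝ) : EReal) := by
      simp only [EReal.coe_div, EReal.coe_sub, EReal.coe_coe_eq_natCast, EReal.coe_one]
    rw [h1]
    congr 2 <;> push_cast <;> ring

/-- Both inequalities hold at every point whose homogeneous exponent does not exceed that of `M`,
hence almost everywhere; the transference is pointwise, and uses neither the differentiable
structure of `M` nor the position of its tangent planes. -/
theorem mainTheorem6 (n d : ℕ) (hn : 1 ≤ n) (M : Set (EuclideanSpace ℝ (Fin n)))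
    (hM : IsDiffSubmanifold d M)
    (hT : ∀ᵐ x ∂(surfaceMeasure d M), ∀ i : Fin n, ¬ TangentOrthAxis d M x i) :
    (∀ θ : Fin n → ℝ, ∀ᵐ x ∂(surfaceMeasure d M),
      (1 - ((n : EReal) - 1) * omegaSimManifold d M) / ((n : EReal) * omegaSimManifold d M)
        ≤ omegaSim x θ) ∧
    (∀ θ : ℝ, ∀ᵐ x ∂(surfaceMeasure d M),
      (n : EReal) / (omegaDualManifold d M - ((n : EReal) - 1)) ≤ omegaDual x θ) := by
  constructor
  · intro θ
    filter_upwards [ae_le_measureExponent (surfaceMeasure d M) (fun x => omegaSim x 0)] with x hx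
    exact transference_le_omegaSim hn hx θ
  · intro θ
    filter_upwards [ae_le_measureExponent (surfaceMeasure d M) (fun x => omegaDual x 0)] with x hx
    exact transference_le_omegaDual hn hx θ
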